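/- All graphs are finite, undirected and without loops unless stated otherwise. For a graph $G$ and an integer $t\ge 1$ let $S_t(G)$ be the graph obtained from $G$ by replacing each edge by a path of length $t$ (that is, with $t-1$ new inner vertices). For $k\ge 1$ the power $G^{k}$ is the graph on $V(G)$ in which $u$ and $v$ (possibly $u=v$, so that loops may occur) are adjacent if and only if there is a walk of length exactly $k$ from $u$ to $v$ in $G$. For non-negative integers $r,s$ put $G^{\frac{2r+1}{2s+1}}=(S_{2s+1}(G))^{2r+1}$, where the fraction is taken as written. Let $\chi$ denote the chromatic number (a graph with a loop has no proper colouring, and then $\chi=\infty$). For integers $d\ge 1$ and $n\ge 2d$ let $K_{n/d}$ be the graph on $\{v_0,\dots,v_{n-1}\}$ in which $v_i$ and $v_j$ are adjacent if and only if $d\le |i-j|\le n-d$, and let the circular chromatic number $\chi_c(G)$ be the minimum of the ratios $n/d$ with $\gcd(n,d)=1$ such that there is a homomorphism $G\to K_{n/d}$. **Theorem 4.** Let $G$ be a non-bipartite graph with chromatic number $\chi(G)$. Then: 1. $\chi(G)\neq\chi_c(G)$ if and only if there are non-negative integers $r,s$ with $\frac{2r+1}{2s+1}>\frac{\chi(G)}{3(\chi(G)-2)}$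 and $\chi\big(G^{\frac{2r+1}{2s+1}}\big)=3$. 2. $\chi_c(G)=\inf\Big\{\frac{2n+1}{n-t}\ :\ n,t\in\mathbb{Z},\ n>t>0,\ \chi\big(G^{\frac{2n+1}{3(2t+1)}}\big)=3\Big\}$, where the set on the right is non-empty. 3. For all non-negative integers $r,s$ with $\frac{2r+1}{2s+1}\le\frac{\chi(G)}{3(\chi(G)-2)}$, one has $\chi\big(G^{\frac{2r+1}{2s+1}}\big)=3$. -/

import Mathlib

namespace FracPower

/-- An undirected graph on `V` in which loops are allowed. Powers of simple graphs live here. -/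
structure LoopGraph (V : Type*) where
  Adj : V → V → Prop
  symm : ∀ u v, Adj u v → Adj v u

/-- A proper colouring with `n` colours; a graph with a loop has none. -/
def LoopGraph.Colorable {V : Type*} (H : LoopGraph V) (n : ℕ) : Prop :=
  ∃ c : V → Fin n, ∀ u v, H.Adj u v → c u ≠ c v

/-- The chromatic number; it is `⊤` if no finite number of colours suffices
(for instance if there is a loop). -/
noncomputable def LoopGraph.chromaticNumber {V : Type*} (H : LoopGraph V) : ℕ∞ :=
  ⨅ n ∈ {n : ℕ | H.Colorable n}, (n : ℕ∞)

/-- The `k`-th power of `G`: `u` and `v` (possibly equal) are adjacent when some walk of length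
exactly `k` joins them. -/
def power {V : Type*} (G : SimpleGraph V) (k : ℕ) : LoopGraph V where
  Adj u v := ∃ p : G.Walk u v, p.length = k
  symm := by
    rintro u v ⟨p, hp⟩
    exact ⟨p.reverse, by simpa using hp⟩

/-- Vertices of the `t`-subdivision: the old vertices, and `t - 1` inner vertices for each edge. -/
abbrev SubdivVertex {V : Type*} (G : SimpleGraph V) (t : ℕ) : Type _ :=
  V ⊕ (G.edgeSet × Fin (t - 1))

/-- The vertex at position `k` (for `0 ≤ k ≤ t`) on the path of length `t` that replaces the
edge `e`; the direction in which the path is traversed is an arbitrary choice. -/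
noncomputable def subdivPoint {V : Type*} (G : SimpleGraph V) (t : ℕ) (e : G.edgeSet) (k : ℕ) :
    SubdivVertex G t :=
  if k = 0 then Sum.inl (Quot.out e.1).1
  else if h : k - 1 < t - 1 then Sum.inr (e, ⟨k - 1, h⟩)
  else Sum.inl (Quot.out e.1).2

theorem out_fst_ne_out_snd {V : Type*} (G : SimpleGraph V) (e : G.edgeSet) :
    (Quot.out e.1).1 ≠ (Quot.out e.1).2 := by
  have h : G.Adj (Quot.out e.1).1 (Quot.out e.1).2 := by
    rw [← SimpleGraph.mem_edgeSet]
    have h2 : s((Quot.out e.1).1, (Quot.out e.1).2) = e.1 := Quot.out_eq e.1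
    rw [h2]
    exact e.2
  exact h.ne

theorem subdivPoint_ne {V : Type*} (G : SimpleGraph V) (t : ℕ) (e : G.edgeSet) (k : ℕ) :
    subdivPoint G t e k ≠ subdivPoint G t e (k + 1) ∨ t ≤ k := by
  by_cases hk : t ≤ k
  · exact Or.inr hk
  · left
    have h0 := out_fst_ne_out_snd G e
    unfold subdivPoint
    split_ifs <;> simp_all <;> omega

/-- The `t`-subdivision of `G` (for `t ≥ 1`): each edge is replaced by a path of length `t`. -/
noncomputable def subdivision {V : Type*} (G : SimpleGraph V) (t : ℕ) :
    SimpleGraph (SubdivVertex G t) where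
  Adj a b := ∃ (e : G.edgeSet) (k : ℕ), k < t ∧
    ((a = subdivPoint G t e k ∧ b = subdivPoint G t e (k + 1)) ∨
      (b = subdivPoint G t e k ∧ a = subdivPoint G t e (k + 1)))
  symm := ⟨by
    rintro a b ⟨e, k, hk, h⟩
    exact ⟨e, k, hk, h.symm⟩⟩
  loopless := ⟨by
    rintro a ⟨e, k, hk, ⟨h1, h2⟩ | ⟨h1, h2⟩⟩ <;>
    · rcases subdivPoint_ne G t e k with h | h
      · exact h (h1.symm.trans h2)
      · omega⟩

/-- The fractional power `G^{a/b}`: the `a`-th power of the `b`-subdivision of `G`. -/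
noncomputable def fracPower {V : Type*} (G : SimpleGraph V) (a b : ℕ) :
    LoopGraph (SubdivVertex G b) :=
  power (subdivision G b) a

/-- The circular complete graph `K_{n/d}`: `i` and `j` are adjacent iff `d ≤ |i - j| ≤ n - d`.
(The clause `i ≠ j` is redundant for `d ≥ 1`, the only case that is used.) -/
def circularComplete (n d : ℕ) : SimpleGraph (Fin n) where
  Adj i j := i ≠ j ∧ (d : ℤ) ≤ |((i : ℕ) : ℤ) - ((j : ℕ) : ℤ)| ∧
    |((i : ℕ) : ℤ) - ((j : ℕ) : ℤ)| ≤ (n : ℤ) - (d : ℤ)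
  symm := ⟨by
    rintro i j ⟨h, h1, h2⟩
    rw [abs_sub_comm] at h1 h2
    exact ⟨h.symm, h1, h2⟩⟩
  loopless := ⟨fun _ h => h.1 rfl⟩

/-- The circular chromatic number: the least ratio `n / d` with `n`, `d` coprime, `d ≥ 1`,
`n ≥ 2 d`, such that `G` admits a homomorphism to `K_{n/d}`. -/
noncomputable def circularChromaticNumber {V : Type*} (G : SimpleGraph V) : ℝ :=
  sInf {x : ℝ | ∃ n d : ℕ, 0 < d ∧ 2 * d ≤ n ∧ Nat.Coprime n d ∧
    Nonempty (G →g circularComplete n d) ∧ x = (n : ℝ) / (d : ℝ)}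

end FracPower

/-!
Let `a` and `b` be odd. The fractional power `G^{a/b} = S_b(G)^a` is 3-colourable if and only if
`S_b(G)` maps to the cycle `C_{3a}`, that is, if and only if `G` maps to `C_{3a} ^ b`, because
subdivision is left adjoint to taking powers (`cyclePowerColorable_subdivision_iff`). Multiplying
by the inverse of `2` modulo `3a` turns `C_{3a} ^ b` into the circular complete graph `K_{3a/d}`
with `2 d = 3 a - b` if `b < 3 a`; if `b ≥ 3 a`, then it has loops and every graph maps to it
(`cyclePowerColorable_iff`). Hence `G^{a/b}` is 3-colourable if and only if `b ≥ 3 a` or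
`χ_c(G) ≤ 6 a / (3 a - b)`, which for a non-bipartite `G` says `a / b ≤ χ_c / (3 (χ_c - 2))`. Fewer
than three colours never suffice for such a `G`, so this is a criterion for chromatic number three
(`fracPower_chromaticNumber_eq_three_iff`). As `2 < χ_c ≤ χ` and `x ↦ x / (3 (x - 2))` is strictly
decreasing on `x > 2`, the three assertions follow, since quotients of odd numbers are dense.

The core is that a 3-colouring of `H ^ a` gives a homomorphism from `H` to `C_{3a}`
(`cyclePowerColorable_of_power_colorable`). The colouring assigns a sign to each step of a walk,
according to the direction in which the colour moves around the triangle, and so a winding number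
to each walk. A walk of odd length at most `a` winds by `1` or `-1`: the winding number is odd,
starts at `1` or `-1`, moves by at most `2` when two steps are added, and can never be `3` or `-3`
because the ends have different colours. So the cost `a * (winding number) + (length)` of walks is
bounded below, and the least cost of a walk from a given vertex is a potential. Together with the
colour it determines a position on `C_{3a}`; by parity, adjacent vertices get adjacent positions.

For the circular chromatic number, homomorphisms to `K_{n/d}` are the same as circular colourings
with real values and circumference `n / d` (`nonempty_hom_circularComplete_iff`). The least
circumference is attained by compactness, and it equals `χ_c`, so that `χ_c ≤ n / d` gives a
homomorphism to `K_{n/d}`.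
-/

namespace FracPower

variable {V : Type*}

/-! ### Circular colourings with real values -/

/-- A circular `r`-colouring of `G`: colours lie on a circle of circumference `r`, represented by
`[0, r)`, and adjacent vertices get colours at circular distance at least `1`. -/
def CircularColorable (G : SimpleGraph V) (r : ℝ) : Prop :=
  ∃ f : V → ℝ, (∀ v, 0 ≤ f v ∧ f v < r) ∧
    ∀ u v, G.Adj u v → 1 ≤ |f u - f v| ∧ |f u - f v| ≤ r - 1

theorem CircularColorable.mono {G : SimpleGraph V} {r r' : ℝ} (h : CircularColorable G r)
    (hr : r ≤ r') : CircularColorable G r' := by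
  obtain ⟨f, hf, hadj⟩ := h
  exact ⟨f, fun v => ⟨(hf v).1, (hf v).2.trans_le hr⟩,
    fun u v huv => ⟨(hadj u v huv).1, (hadj u v huv).2.trans (by linarith)⟩⟩

/-- The half-open range of colours may be closed up: the colour `r` is the same point of the
circle as `0`. -/
theorem circularColorable_of_le {G : SimpleGraph V} {r : ℝ} (hr : 0 < r) (f : V → ℝ)
    (hf : ∀ v, 0 ≤ f v ∧ f v ≤ r)
    (hadj : ∀ u v, G.Adj u v → 1 ≤ |f u - f v| ∧ |f u - f v| ≤ r - 1) :
    CircularColorable G r := by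
  refine ⟨fun v => if f v = r then 0 else f v, fun v => ?_, fun u v huv => ?_⟩
  · dsimp only
    split_ifs with h
    · exact ⟨le_rfl, hr⟩
    · exact ⟨(hf v).1, lt_of_le_of_ne (hf v).2 h⟩
  · obtain ⟨h1, h2⟩ := hadj u v huv
    have hu := hf u
    have hv := hf v
    dsimp only
    split_ifs with h h' h'
    · rw [h, h', sub_self, abs_zero] at h1
      linarith
    · rw [h, abs_of_nonneg (by linarith)] at h1 h2
      rw [abs_of_nonpos (by linarith)]
      constructor <;> linarith
    · rw [h', abs_of_nonpos (by linarith)] at h1 h2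
      rw [abs_of_nonneg (by linarith)]
      constructor <;> linarith
    · exact ⟨h1, h2⟩

/-- Rounding down `d • f` turns a circular `n / d`-colouring into a homomorphism
to `K_{n/d}`. -/
theorem nonempty_hom_circularComplete_iff (G : SimpleGraph V) {n d : ℕ} (hd : 0 < d) :
    Nonempty (G →g circularComplete n d) ↔ CircularColorable G ((n : ℝ) / d) := by
  have hd' : (0 : ℝ) < d := by exact_mod_cast hd
  constructor
  · rintro ⟨φ⟩
    refine ⟨fun v => ((φ v : ℕ) : ℝ) / d, fun v => ⟨by positivity, ?_⟩, fun u v huv => ?_⟩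
    · have : ((φ v : ℕ) : ℝ) < n := by exact_mod_cast (φ v).2
      exact div_lt_div_of_pos_right this hd'
    · obtain ⟨-, h1, h2⟩ := φ.map_adj huv
      have h1' : (d : ℝ) ≤ |((φ u : ℕ) : ℝ) - ((φ v : ℕ) : ℝ)| := by exact_mod_cast h1
      have h2' : |((φ u : ℕ) : ℝ) - ((φ v : ℕ) : ℝ)| ≤ (n : ℝ) - d := by exact_mod_cast h2
      rw [← sub_div, abs_div, abs_of_pos hd', le_div_iff₀ hd', div_le_iff₀ hd', sub_mul,
        div_mul_cancel₀ _ hd'.ne']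
      constructor <;> linarith
  · rintro ⟨f, hf, hadj⟩
    have hlt : ∀ v, ⌊(d : ℝ) * f v⌋₊ < n := fun v => by
      rw [Nat.floor_lt (mul_nonneg hd'.le (hf v).1), mul_comm, ← lt_div_iff₀ hd']
      exact (hf v).2
    -- both bounds on the distance survive rounding because `d` and `n - d` are integers
    have key : ∀ u v, G.Adj u v → f v ≤ f u →
        (⌊(d : ℝ) * f v⌋₊ : ℤ) + d ≤ ⌊(d : ℝ) * f u⌋₊ ∧
        (⌊(d : ℝ) * f u⌋₊ : ℤ) ≤ ⌊(d : ℝ) * f v⌋₊ + (n - d) := by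
      intro u v huv hle
      obtain ⟨h1, h2⟩ := hadj u v huv
      rw [abs_of_nonneg (by linarith)] at h1 h2
      rw [Int.natCast_floor_eq_floor (mul_nonneg hd'.le (hf u).1),
        Int.natCast_floor_eq_floor (mul_nonneg hd'.le (hf v).1)]
      have h2' : (d : ℝ) * (f u - f v) ≤ n - d := by
        calc (d : ℝ) * (f u - f v) ≤ d * (n / d - 1) := by gcongr
          _ = n - d := by field_simp
      have h1' : (d : ℝ) * 1 ≤ d * (f u - f v) := by gcongr
      constructor
      · rw [Int.le_floor]
        push_cast
        linarith [Int.floor_le ((d : ℝ) * f v)]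
      · rw [← Int.lt_add_one_iff, Int.floor_lt]
        push_cast
        linarith [Int.lt_floor_add_one ((d : ℝ) * f v)]
    refine ⟨⟨fun v => ⟨⌊(d : ℝ) * f v⌋₊, hlt v⟩, fun {u v} huv => ?_⟩⟩
    simp only [circularComplete, ne_eq, Fin.mk.injEq]
    rcases le_total (f v) (f u) with h | h
    · obtain ⟨h1, h2⟩ := key u v huv h
      rw [abs_of_nonneg (by omega)]
      omega
    · obtain ⟨h1, h2⟩ := key v u huv.symm h
      rw [abs_of_nonpos (by omega)]
      omega

theorem circularColorable_of_colorable {G : SimpleGraph V} {k : ℕ} (h : G.Colorable k) :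
    CircularColorable G k := by
  obtain ⟨c⟩ := h
  refine ⟨fun v => ((c v : ℕ) : ℝ), fun v => ⟨by positivity, Nat.cast_lt.2 (c v).2⟩,
    fun u v huv => ?_⟩
  have hne : (c u : ℕ) ≠ c v := fun h => c.valid huv (Fin.ext h)
  have hu := (c u).2
  have hv := (c v).2
  have h1 : 1 ≤ |((c u : ℕ) : ℤ) - ((c v : ℕ) : ℤ)| := by
    exact Int.one_le_abs (by omega)
  have h2 : |((c u : ℕ) : ℤ) - ((c v : ℕ) : ℤ)| ≤ (k : ℤ) - 1 := by
    rw [abs_le]; omega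
  dsimp only
  constructor
  · exact_mod_cast h1
  · have : ((|((c u : ℕ) : ℤ) - ((c v : ℕ) : ℤ)| : ℤ) : ℝ) ≤ (((k : ℤ) - 1 : ℤ) : ℝ) :=
      Int.cast_le.2 h2
    push_cast at this
    exact this

theorem isBipartite_of_circularColorable_two {G : SimpleGraph V} (h : CircularColorable G 2) :
    G.IsBipartite := by
  obtain ⟨f, hf, hadj⟩ := h
  refine ⟨SimpleGraph.Coloring.mk (fun v => if f v < 1 then 0 else 1) fun {u v} huv => ?_⟩
  obtain ⟨h1, h2⟩ := hadj u v huv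
  have hu := hf u
  have hv := hf v
  rcases abs_cases (f u - f v) with ⟨h, h'⟩ | ⟨h, h'⟩ <;> rw [h] at h1 h2
  · rw [if_neg (by linarith), if_pos (by linarith)]; simp
  · rw [if_pos (by linarith), if_neg (by linarith)]; simp

/-- The least circumference of a circular colouring exists, by compactness. -/
theorem exists_least_circularColorable [Finite V] {G : SimpleGraph V} (hG : ¬ G.IsBipartite)
    {k : ℕ} (hk : G.Colorable k) :
    ∃ r₀ : ℝ, 2 < r₀ ∧ ∀ r, CircularColorable G r ↔ r₀ ≤ r := by
  have two_lt : ∀ r, CircularColorable G r → 2 < r := fun r hr => by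
    by_contra! h
    exact hG (isBipartite_of_circularColorable_two (hr.mono h))
  let K : Set (ℝ × (V → ℝ)) := {p | (0 ≤ p.1 ∧ p.1 ≤ k) ∧ (∀ v, 0 ≤ p.2 v ∧ p.2 v ≤ p.1) ∧
    ∀ u v, G.Adj u v → 1 ≤ |p.2 u - p.2 v| ∧ |p.2 u - p.2 v| ≤ p.1 - 1}
  have hclosed : IsClosed K := by
    refine IsClosed.and ?_ (IsClosed.and ?_ ?_)
    · exact (isClosed_le (by fun_prop) (by fun_prop)).and (isClosed_le (by fun_prop) (by fun_prop))
    · rw [Set.ofPred_forall]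
      exact isClosed_iInter fun v => (isClosed_le (by fun_prop) (by fun_prop)).and
        (isClosed_le (by fun_prop) (by fun_prop))
    · simp only [Set.ofPred_forall]
      exact isClosed_iInter fun u => isClosed_iInter fun v => isClosed_iInter fun _ =>
        (isClosed_le (by fun_prop) (by fun_prop)).and (isClosed_le (by fun_prop) (by fun_prop))
  have hcompact : IsCompact K := by
    refine ((isCompact_Icc (a := (0 : ℝ)) (b := k)).prod
      (isCompact_univ_pi fun _ : V => isCompact_Icc (a := (0 : ℝ)) (b := k))).of_isClosed_subset
      hclosed ?_
    rintro ⟨r, f⟩ ⟨h1, h2, -⟩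
    exact ⟨h1, fun v _ => ⟨(h2 v).1, (h2 v).2.trans h1.2⟩⟩
  have mem_K : ∀ r, CircularColorable G r → r ≤ k → ∃ f, (r, f) ∈ K := by
    intro r hr hrk
    have h2 := two_lt r hr
    obtain ⟨f, hf, hadj⟩ := hr
    exact ⟨f, ⟨by linarith, hrk⟩, fun v => ⟨(hf v).1, (hf v).2.le⟩, hadj⟩
  have hGk := circularColorable_of_colorable hk
  obtain ⟨f₀, hf₀⟩ := mem_K k hGk le_rfl
  obtain ⟨⟨r₀, f⟩, hmem, hmin⟩ := hcompact.exists_isMinOn ⟨_, hf₀⟩ continuous_fst.continuousOn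
  have hpos : 0 < r₀ := by
    -- a graph that is not bipartite has an edge
    by_contra! h
    refine hG ⟨SimpleGraph.Coloring.mk (fun _ => 0) fun {u v} huv => ?_⟩
    have := hmem.2.2 u v huv
    dsimp only at this
    linarith
  have hr₀ : CircularColorable G r₀ := circularColorable_of_le hpos f hmem.2.1 hmem.2.2
  refine ⟨r₀, two_lt _ hr₀, fun r => ⟨fun hr => ?_, hr₀.mono⟩⟩
  rcases le_total r k with h | h
  · obtain ⟨g, hg⟩ := mem_K r hr h
    exact hmin hg
  · exact hmem.1.2.trans h

/-- The circular chromatic number is the least circumference of a real circular colouring. -/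
theorem circularColorable_iff_circularChromaticNumber_le [Finite V] {G : SimpleGraph V}
    (hG : ¬ G.IsBipartite) {k : ℕ} (hk : G.Colorable k) :
    2 < circularChromaticNumber G ∧
      ∀ r, CircularColorable G r ↔ circularChromaticNumber G ≤ r := by
  obtain ⟨r₀, h2, hr₀⟩ := exists_least_circularColorable hG hk
  suffices h : circularChromaticNumber G = r₀ by rw [h]; exact ⟨h2, hr₀⟩
  have lower : ∀ x ∈ {x : ℝ | ∃ n d : ℕ, 0 < d ∧ 2 * d ≤ n ∧ Nat.Coprime n d ∧
      Nonempty (G →g circularComplete n d) ∧ x = (n : ℝ) / (d : ℝ)}, r₀ ≤ x := by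
    rintro x ⟨n, d, hd, -, -, hhom, rfl⟩
    exact (hr₀ _).1 ((nonempty_hom_circularComplete_iff G hd).1 hhom)
  have mem : ∀ q : ℚ, r₀ ≤ q → (q : ℝ) ∈ {x : ℝ | ∃ n d : ℕ, 0 < d ∧ 2 * d ≤ n ∧
      Nat.Coprime n d ∧ Nonempty (G →g circularComplete n d) ∧ x = (n : ℝ) / (d : ℝ)} := by
    intro q hq
    have hq2 : (2 : ℝ) < q := h2.trans_le hq
    have hq0 : 0 < q.num := by
      rw [Rat.num_pos]
      exact_mod_cast (zero_lt_two.trans hq2)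
    have hd : (0 : ℝ) < q.den := by exact_mod_cast q.pos
    have hnum : ((q.num.natAbs : ℕ) : ℝ) = (q.num : ℝ) := by
      rw [← Int.cast_natCast, Int.natAbs_of_nonneg hq0.le]
    have heq : (q : ℝ) = ((q.num.natAbs : ℕ) : ℝ) / (q.den : ℝ) := by
      rw [hnum, Rat.cast_def]
    refine ⟨q.num.natAbs, q.den, q.pos, ?_, q.reduced, ?_, heq⟩
    · rw [heq, lt_div_iff₀ hd] at hq2
      exact_mod_cast hq2.le
    · rw [nonempty_hom_circularComplete_iff G q.pos, ← heq, hr₀]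
      exact hq
  refine le_antisymm (le_of_forall_gt_imp_ge_of_dense fun x hx => ?_) ?_
  · obtain ⟨q, hq1, hq2⟩ := exists_rat_btwn hx
    exact (csInf_le ⟨r₀, lower⟩ (mem q hq1.le)).trans hq2.le
  · obtain ⟨q, hq1, -⟩ := exists_rat_btwn (lt_add_one r₀)
    exact le_csInf ⟨_, mem q hq1.le⟩ lower

/-! ### Maps to powers of an odd cycle -/

/-- For odd `m` and `b`: `G` has a homomorphism to the `b`-th power of the cycle `C_m`. The map is
given by integer representatives of vertices of `C_m`; walks of length `b` in `C_m` realise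
exactly the odd displacements `D` with `|D| ≤ b`. -/
def CyclePowerColorable (G : SimpleGraph V) (m b : ℤ) : Prop :=
  ∃ p : V → ℤ, ∀ u v, G.Adj u v → ∃ D : ℤ, Odd D ∧ |D| ≤ b ∧ m ∣ p v - p u - D

/-- Multiplication by `(m + 1) / 2`, the inverse of `2` modulo `m`, identifies `C_m ^ b` with the
circular complete graph `K_{m/d}` where `2 d = m - b`. -/
theorem exists_half_of_dvd {m : ℤ} (hm : Odd m) (hpos : 0 < m) (x y D : ℤ) (hD : Odd D)
    (h : m ∣ y - x - D) :
    ∃ k : ℤ, Odd k ∧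
      2 * ((y * ((m + 1) / 2)) % m - (x * ((m + 1) / 2)) % m) = D + m * k := by
  obtain ⟨j, rfl⟩ := hm
  obtain ⟨z, hz⟩ := h
  obtain ⟨i, rfl⟩ := hD
  have hj : (2 * j + 1 + 1) / 2 = j + 1 := by omega
  rw [hj]
  have h1 := Int.emod_add_mul_ediv (y * (j + 1)) (2 * j + 1)
  have h2 := Int.emod_add_mul_ediv (x * (j + 1)) (2 * j + 1)
  generalize (y * (j + 1)) % (2 * j + 1) = Y at *
  generalize (x * (j + 1)) % (2 * j + 1) = X at *
  generalize (y * (j + 1)) / (2 * j + 1) = A at *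
  generalize (x * (j + 1)) / (2 * j + 1) = B at *
  have hyx : y - x = (2 * j + 1) * z + (2 * i + 1) := by linarith
  have e : 2 * (Y - X) = (2 * i + 1) + (2 * j + 1) * (y - x + z - 2 * (A - B)) := by
    linear_combination 2 * h1 - 2 * h2 + hyx
  refine ⟨y - x + z - 2 * (A - B), ?_, e⟩
  by_contra hk
  rw [Int.not_odd_iff_even] at hk
  have h3 : Odd ((2 * i + 1) + (2 * j + 1) * (y - x + z - 2 * (A - B))) :=
    Odd.add_even ⟨i, rfl⟩ (hk.mul_left _)
  rw [← e] at h3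
  exact (Int.not_odd_iff_even.2 (even_two_mul _)) h3

theorem cyclePowerColorable_iff (G : SimpleGraph V) {m b : ℕ} (hm : Odd m) (hb : Odd b) :
    CyclePowerColorable G m b ↔ m ≤ b ∨ CircularColorable G (2 * (m : ℝ) / (m - b)) := by
  have hmZ : Odd (m : ℤ) := by exact_mod_cast hm
  have hm0 : (0 : ℤ) < m := by exact_mod_cast hm.pos
  rcases le_or_gt m b with hle | hlt
  · simp only [hle, true_or, iff_true]
    -- the displacement `m` is a closed walk around the cycle
    exact ⟨fun _ => 0, fun u v _ => ⟨m, hmZ, by rw [abs_of_pos hm0]; exact_mod_cast hle, by simp⟩⟩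
  obtain ⟨d, hd⟩ : ∃ d : ℕ, m = b + 2 * d := by
    obtain ⟨i, rfl⟩ := hm
    obtain ⟨j, rfl⟩ := hb
    exact ⟨i - j, by omega⟩
  have hd0 : 0 < d := by omega
  have hratio : 2 * (m : ℝ) / (m - b) = (m : ℝ) / d := by
    have : (m : ℝ) - b = 2 * d := by rw [hd]; push_cast; ring
    rw [this, mul_div_mul_left _ _ two_ne_zero]
  rw [hratio, ← nonempty_hom_circularComplete_iff G hd0]
  simp only [not_le.2 hlt, false_or]
  constructor
  · rintro ⟨p, hp⟩
    let y : V → ℤ := fun v => (p v * ((m + 1) / 2)) % m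
    have hy0 : ∀ v, 0 ≤ y v := fun v => Int.emod_nonneg _ hm0.ne'
    have hym : ∀ v, y v < m := fun v => Int.emod_lt_of_pos _ hm0
    refine ⟨⟨fun v => ⟨(y v).toNat, by have := hy0 v; have := hym v; omega⟩, fun {u v} huv => ?_⟩⟩
    obtain ⟨D, hDodd, hDb, hdvd⟩ := hp u v huv
    obtain ⟨k, hk, e⟩ := exists_half_of_dvd hmZ hm0 _ _ D hDodd hdvd
    change 2 * (y v - y u) = D + m * k at e
    have hu0 := hy0 u
    have hv0 := hy0 v
    have hum := hym u
    have hvm := hym v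
    rw [abs_le] at hDb
    -- `k` is odd, and `|k| ≥ 3` would put `2 (y v - y u)` outside `(-2 m, 2 m)`
    have hk1 : k = 1 ∨ k = -1 := by
      obtain ⟨i, rfl⟩ := hk
      have h1 : i < 1 := by by_contra! h; nlinarith
      have h2 : -2 < i := by by_contra! h; nlinarith
      omega
    simp only [circularComplete, ne_eq, Fin.mk.injEq, Int.toNat_of_nonneg hu0,
      Int.toNat_of_nonneg hv0]
    rcases hk1 with rfl | rfl
    · rw [abs_of_nonpos (by omega)]
      omega
    · rw [abs_of_nonneg (by omega)]
      omega
  · rintro ⟨φ⟩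
    refine ⟨fun v => 2 * ((φ v : ℕ) : ℤ), fun u v huv => ?_⟩
    obtain ⟨-, h1, h2⟩ := φ.map_adj huv
    rcases abs_cases (((φ u : ℕ) : ℤ) - ((φ v : ℕ) : ℤ)) with ⟨h, -⟩ | ⟨h, -⟩ <;>
      rw [h] at h1 h2
    · refine ⟨2 * (φ v : ℕ) - 2 * (φ u : ℕ) + m, (Even.add_odd ?_ hmZ), ?_, ⟨-1, by ring⟩⟩
      · exact ⟨(φ v : ℕ) - (φ u : ℕ), by ring⟩
      · rw [abs_le]; omega
    · refine ⟨2 * (φ v : ℕ) - 2 * (φ u : ℕ) - m, (Even.sub_odd ?_ hmZ), ?_, ⟨1, by ring⟩⟩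
      · exact ⟨(φ v : ℕ) - (φ u : ℕ), by ring⟩
      · rw [abs_le]; omega

/-! ### Subdivisions -/

theorem subdivPoint_zero (G : SimpleGraph V) (t : ℕ) (e : G.edgeSet) :
    subdivPoint G t e 0 = Sum.inl (Quot.out e.1).1 := by
  simp [subdivPoint]

theorem subdivPoint_last (G : SimpleGraph V) {t : ℕ} (ht : 0 < t) (e : G.edgeSet) :
    subdivPoint G t e t = Sum.inl (Quot.out e.1).2 := by
  simp [subdivPoint, ht.ne']

theorem subdivision_adj (G : SimpleGraph V) (t : ℕ) (e : G.edgeSet) {k : ℕ} (hk : k < t) :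
    (subdivision G t).Adj (subdivPoint G t e k) (subdivPoint G t e (k + 1)) :=
  ⟨e, k, hk, Or.inl ⟨rfl, rfl⟩⟩

theorem adj_out (G : SimpleGraph V) (e : G.edgeSet) :
    G.Adj (Quot.out e.1).1 (Quot.out e.1).2 := by
  rw [← SimpleGraph.mem_edgeSet]
  have h : s((Quot.out e.1).1, (Quot.out e.1).2) = e.1 := Quot.out_eq e.1
  rw [h]
  exact e.2

/-- Symmetric relations on adjacent pairs need only be checked in the direction chosen by
`Quot.out`. -/
theorem of_forall_edge_out {G : SimpleGraph V} {P : V → V → Prop} (hsymm : ∀ u v, P u v → P v u)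
    (h : ∀ e : G.edgeSet, P (Quot.out e.1).1 (Quot.out e.1).2) (u v : V) (huv : G.Adj u v) :
    P u v := by
  have h1 := h ⟨s(u, v), huv⟩
  have h2 : s((Quot.out s(u, v)).1, (Quot.out s(u, v)).2) = s(u, v) := Quot.out_eq _
  rcases Sym2.eq_iff.1 h2 with ⟨h3, h4⟩ | ⟨h3, h4⟩
  · simpa only [h3, h4] using h1
  · apply hsymm
    simpa only [h3, h4] using h1

/-- Subdivision is left adjoint to taking powers: `S_b(G) → C_m` if and only if `G → C_m ^ b`. -/
theorem cyclePowerColorable_subdivision_iff (G : SimpleGraph V) (m : ℤ) {b : ℕ} (hb : Odd b) :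
    CyclePowerColorable (subdivision G b) m 1 ↔ CyclePowerColorable G m b := by
  have hbZ : Odd (b : ℤ) := by exact_mod_cast hb
  constructor
  · rintro ⟨q, hq⟩
    refine ⟨fun v => q (Sum.inl v), of_forall_edge_out ?_ fun e => ?_⟩
    · rintro u v ⟨D, hD, hDb, hdvd⟩
      refine ⟨-D, hD.neg, by rwa [abs_neg], ?_⟩
      obtain ⟨z, hz⟩ := hdvd
      exact ⟨-z, by linear_combination -hz⟩
    · have key : ∀ k : ℕ, k ≤ b → ∃ D : ℤ, Even (D - k) ∧ |D| ≤ k ∧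
          m ∣ q (subdivPoint G b e k) - q (subdivPoint G b e 0) - D := by
        intro k
        induction k with
        | zero => exact fun _ => ⟨0, by simp⟩
        | succ k ih =>
          intro hk
          obtain ⟨D, hD, hDk, hdvd⟩ := ih (by omega)
          obtain ⟨D', hD', hDk', hdvd'⟩ := hq _ _ (subdivision_adj G b e (k := k) (by omega))
          refine ⟨D + D', ?_, ?_, ?_⟩
          · have : D + D' - ((k + 1 : ℕ) : ℤ) = (D - k) + (D' - 1) := by push_cast; ring
            rw [this]
            exact hD.add (hD'.sub_odd odd_one)
          · push_cast
            exact (abs_add_le _ _).trans (add_le_add hDk hDk')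
          · obtain ⟨z, hz⟩ := hdvd
            obtain ⟨z', hz'⟩ := hdvd'
            exact ⟨z + z', by linear_combination hz + hz'⟩
      obtain ⟨D, hD, hDb, hdvd⟩ := key b le_rfl
      rw [subdivPoint_zero, subdivPoint_last G hb.pos] at hdvd
      refine ⟨D, ?_, hDb, hdvd⟩
      have := hD.add_odd hbZ
      rwa [sub_add_cancel] at this
  · rintro ⟨p, hp⟩
    choose D hDodd hDb hdvd using fun e : G.edgeSet => hp _ _ (adj_out G e)
    -- along a subdivided edge go up `(b + D) / 2` steps and then down
    let w : ℤ → ℤ → ℤ := fun D k => if k ≤ (b + D) / 2 then k else 2 * ((b + D) / 2) - k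
    let q : SubdivVertex G b → ℤ := Sum.elim p fun x =>
      p (Quot.out x.1.1).1 + w (D x.1) ((x.2 : ℕ) + 1)
    have hq : ∀ (e : G.edgeSet) (k : ℕ), k ≤ b →
        m ∣ q (subdivPoint G b e k) - (p (Quot.out e.1).1 + w (D e) k) := by
      intro e k hk
      have hDe := hDb e
      rw [abs_le] at hDe
      unfold subdivPoint
      split_ifs with h0 h1
      · subst h0
        have : w (D e) 0 = 0 := if_pos (by omega)
        simp [q, this]
      · have : ((k - 1 : ℕ) : ℤ) + 1 = k := by omega
        simp [q, this]
      · have hkb : k = b := by omega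
        subst hkb
        have hw : w (D e) k = D e := by
          have h2 := (hbZ.add_odd (hDodd e)).two_dvd
          simp only [w]
          split_ifs <;> omega
        rw [hw]
        convert hdvd e using 1
        simp only [q, Sum.elim_inl]
        ring
    refine ⟨q, ?_⟩
    rintro x y ⟨e, k, hk, h⟩
    have hw : w (D e) (k + 1 : ℕ) - w (D e) k = 1 ∨ w (D e) (k + 1 : ℕ) - w (D e) k = -1 := by
      simp only [w]
      push_cast
      split_ifs <;> omega
    have h1 := dvd_sub (hq e (k + 1) (by omega)) (hq e k hk.le)
    rcases h with ⟨rfl, rfl⟩ | ⟨rfl, rfl⟩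
    · refine ⟨w (D e) (k + 1 : ℕ) - w (D e) k, ?_, ?_, ?_⟩
      · rcases hw with h | h <;> rw [h] <;> decide
      · rcases hw with h | h <;> rw [h] <;> decide
      · obtain ⟨z, hz⟩ := h1
        exact ⟨z, by linear_combination hz⟩
    · refine ⟨-(w (D e) (k + 1 : ℕ) - w (D e) k), ?_, ?_, ?_⟩
      · rcases hw with h | h <;> rw [h] <;> decide
      · rcases hw with h | h <;> rw [h] <;> decide
      · obtain ⟨z, hz⟩ := h1
        exact ⟨-z, by linear_combination -hz⟩

/-! ### Three-colourings of odd powers -/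

/-- The sign of a step between two colours in `ℤ/3`: it is `1` if the colour increases by `1`
modulo `3`, and `-1` otherwise. -/
def colorStep {W : Type*} (c : W → Fin 3) (u v : W) : ℤ :=
  if (3 : ℤ) ∣ ((c v : ℕ) : ℤ) - ((c u : ℕ) : ℤ) - 1 then 1 else -1

theorem colorStep_eq_or {W : Type*} (c : W → Fin 3) (u v : W) :
    colorStep c u v = 1 ∨ colorStep c u v = -1 := by
  unfold colorStep
  split_ifs <;> simp

theorem three_dvd_sub_colorStep {W : Type*} {c : W → Fin 3} {u v : W} (h : c u ≠ c v) :
    (3 : ℤ) ∣ ((c v : ℕ) : ℤ) - ((c u : ℕ) : ℤ) - colorStep c u v := by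
  have h' : (c u : ℕ) ≠ c v := fun h' => h (Fin.ext h')
  have hu := (c u).2
  have hv := (c v).2
  unfold colorStep
  split_ifs <;> omega

theorem colorStep_swap {W : Type*} {c : W → Fin 3} {u v : W} (h : c u ≠ c v) :
    colorStep c v u = -colorStep c u v := by
  have h1 := three_dvd_sub_colorStep h
  have h2 := three_dvd_sub_colorStep h.symm
  rcases colorStep_eq_or c u v with h3 | h3 <;> rcases colorStep_eq_or c v u with h4 | h4 <;>
    rw [h3, h4] <;> rw [h3] at h1 <;> rw [h4] at h2 <;> omega

/-- Some walk of length `k` from `u` to `v` has winding number `w`, the sum of the signs of its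
steps. -/
def WalkWinding {W : Type*} (H : SimpleGraph W) (c : W → Fin 3) : ℕ → ℤ → W → W → Prop
  | 0, w, u, v => u = v ∧ w = 0
  | k + 1, w, u, v => ∃ x, H.Adj u x ∧ WalkWinding H c k (w - colorStep c u x) x v

section Winding

variable {W : Type*} {H : SimpleGraph W} {c : W → Fin 3}

theorem WalkWinding.exists_walk {k : ℕ} {w : ℤ} {u v : W} (h : WalkWinding H c k w u v) :
    ∃ p : H.Walk u v, p.length = k := by
  induction k generalizing w u with
  | zero =>
    obtain ⟨rfl, -⟩ := h
    exact ⟨.nil, rfl⟩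
  | succ k ih =>
    obtain ⟨x, hx, h⟩ := h
    obtain ⟨p, rfl⟩ := ih h
    exact ⟨.cons hx p, rfl⟩

theorem WalkWinding.even_sub {k : ℕ} {w : ℤ} {u v : W} (h : WalkWinding H c k w u v) :
    Even (w - k) := by
  induction k generalizing w u with
  | zero => simp [h.2]
  | succ k ih =>
    obtain ⟨x, -, h⟩ := h
    have h1 := ih h
    rw [Int.even_iff] at h1 ⊢
    rcases colorStep_eq_or c u x with h2 | h2 <;> rw [h2] at h1 <;> push_cast <;> omega

theorem WalkWinding.three_dvd (hc : ∀ u v, H.Adj u v → c u ≠ c v) {k : ℕ} {w : ℤ} {u v : W}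
    (h : WalkWinding H c k w u v) : (3 : ℤ) ∣ ((c v : ℕ) : ℤ) - ((c u : ℕ) : ℤ) - w := by
  induction k generalizing w u with
  | zero =>
    obtain ⟨rfl, rfl⟩ := h
    simp
  | succ k ih =>
    obtain ⟨x, hx, h⟩ := h
    obtain ⟨z, hz⟩ := ih h
    obtain ⟨z', hz'⟩ := three_dvd_sub_colorStep (hc u x hx)
    exact ⟨z + z', by linear_combination hz + hz'⟩

theorem WalkWinding.split {k l : ℕ} {w : ℤ} {u v : W} (h : WalkWinding H c (k + l) w u v) :
    ∃ x w', WalkWinding H c k w' u x ∧ WalkWinding H c l (w - w') x v := by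
  induction k generalizing w u with
  | zero =>
    rw [zero_add] at h
    exact ⟨u, 0, ⟨rfl, rfl⟩, by rwa [sub_zero]⟩
  | succ k ih =>
    rw [Nat.succ_add] at h
    obtain ⟨x, hx, h⟩ := h
    obtain ⟨y, w', h1, h2⟩ := ih h
    refine ⟨y, w' + colorStep c u x, ⟨x, hx, by rwa [add_sub_cancel_right]⟩, ?_⟩
    convert h2 using 1
    ring

end Winding

/-- A walk of odd length at most `a` extends to one of length `a` by going back and forth along an
edge, so its ends get different colours. -/
theorem ne_of_walk_of_power_coloring {W α : Type*} {H : SimpleGraph W} {a : ℕ} {c : W → α}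
    (hc : ∀ u v, (power H a).Adj u v → c u ≠ c v) (ha : Odd a) {u v : W} (p : H.Walk u v)
    (hp : Odd p.length) (hpa : p.length ≤ a) : c u ≠ c v := by
  obtain ⟨j, hj⟩ : ∃ j, a = p.length + 2 * j := by
    obtain ⟨x, rfl⟩ := ha
    obtain ⟨y, hy⟩ := hp
    exact ⟨x - y, by omega⟩
  have key : ∀ j : ℕ, ∃ q : H.Walk u v, q.length = p.length + 2 * j := by
    intro j
    induction j with
    | zero => exact ⟨p, rfl⟩
    | succ j ih =>
      obtain ⟨q, hq⟩ := ih
      cases p with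
      | nil => simp at hp
      | cons h p' => exact ⟨.cons h (.cons h.symm q), by simp [hq]; ring⟩
  obtain ⟨q, hq⟩ := key j
  exact hc u v ⟨q, by omega⟩

theorem ne_of_adj_of_power_coloring {W α : Type*} {H : SimpleGraph W} {a : ℕ} {c : W → α}
    (hc : ∀ u v, (power H a).Adj u v → c u ≠ c v) (ha : Odd a) {u v : W} (h : H.Adj u v) :
    c u ≠ c v :=
  ne_of_walk_of_power_coloring hc ha (.cons h .nil) (by simp) ha.pos

/-- In a 3-colouring of the `a`-th power, walks of odd length at most `a` wind by `1` or `-1`: the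
winding number is odd, changes by at most `2` when the walk grows by two steps, and is not
divisible by `3`. -/
theorem WalkWinding.eq_one_or_neg_one {W : Type*} {H : SimpleGraph W} {a : ℕ} {c : W → Fin 3}
    (hc : ∀ u v, (power H a).Adj u v → c u ≠ c v) (ha : Odd a) (j : ℕ) {w : ℤ} {u v : W}
    (h : WalkWinding H c (2 * j + 1) w u v) (hj : 2 * j + 1 ≤ a) : w = 1 ∨ w = -1 := by
  induction j generalizing w u with
  | zero =>
    obtain ⟨x, -, -, h⟩ := h
    have := colorStep_eq_or c u x
    omega
  | succ j ih =>
    have hne : c u ≠ c v := by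
      obtain ⟨p, hp⟩ := h.exists_walk
      exact ne_of_walk_of_power_coloring hc ha p (by rw [hp]; exact ⟨j + 1, rfl⟩) (by omega)
    have hdvd := h.three_dvd fun _ _ => ne_of_adj_of_power_coloring hc ha
    have hodd := h.even_sub
    obtain ⟨x, hx, y, hy, h⟩ := h
    have h1 := ih h (by omega)
    have h2 := colorStep_eq_or c u x
    have h3 := colorStep_eq_or c x y
    have hne' : (c u : ℕ) ≠ c v := fun h => hne (Fin.ext h)
    have hu := (c u).2
    have hv := (c v).2
    omega

/-- Lower bound for the cost `a * w + k` of a walk of length `k` and winding number `w`: blocks of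
`a` steps have non-negative cost, because they wind by at least `-1`. -/
theorem WalkWinding.neg_two_mul_le {W : Type*} {H : SimpleGraph W} {a : ℕ} {c : W → Fin 3}
    (hc : ∀ u v, (power H a).Adj u v → c u ≠ c v) (ha : Odd a) (k : ℕ) {w : ℤ} {u v : W}
    (h : WalkWinding H c k w u v) : -2 * (a : ℤ) ≤ a * w + k := by
  obtain ⟨i, hi⟩ := ha
  have ha : Odd a := ⟨i, hi⟩
  induction k using Nat.strong_induction_on generalizing w u with
  | _ k ih =>
    rcases lt_or_ge k a with hka | hka
    · have hw : -2 ≤ w := by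
        rcases Nat.even_or_odd' k with ⟨j, rfl | rfl⟩
        · cases j with
          | zero =>
            obtain ⟨-, rfl⟩ := h
            norm_num
          | succ j =>
            obtain ⟨x, -, h⟩ := h
            have h1 := h.eq_one_or_neg_one hc ha j (by omega)
            have h2 := colorStep_eq_or c u x
            omega
        · have := h.eq_one_or_neg_one hc ha j (by omega)
          omega
      nlinarith
    · obtain ⟨l, rfl⟩ := Nat.exists_eq_add_of_le hka
      obtain ⟨x, w', h1, h2⟩ := h.split
      have h3 := ih l (by have := ha.pos; omega) h2
      rw [hi] at h1
      have h4 := h1.eq_one_or_neg_one hc ha i hi.ge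
      push_cast
      rcases h4 with rfl | rfl <;> linarith

/-- The potential `F u`, the least cost `a * w + k` of a walk starting at `u`, changes along each
edge by `a` times the sign of the step, up to `1`; this lifts a 3-colouring of the `a`-th power to
a homomorphism to `C_{3a}`. -/
theorem cyclePowerColorable_of_power_colorable {W : Type*} (H : SimpleGraph W) {a : ℕ}
    (ha : Odd a) (h : (power H a).Colorable 3) : CyclePowerColorable H (3 * a) 1 := by
  obtain ⟨c, hc⟩ := h
  have hadj : ∀ u v, H.Adj u v → c u ≠ c v := fun _ _ => ne_of_adj_of_power_coloring hc ha
  have hex : ∀ u, ∃ z : ℤ, (∃ k w v, WalkWinding H c k w u v ∧ z = a * w + k) ∧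
      ∀ z' : ℤ, (∃ k w v, WalkWinding H c k w u v ∧ z' = a * w + k) → z ≤ z' := by
    intro u
    refine Int.exists_least_of_bdd ⟨-2 * a, ?_⟩ ⟨0, 0, 0, u, ⟨rfl, rfl⟩, by simp⟩
    rintro z ⟨k, w, v, h, rfl⟩
    exact h.neg_two_mul_le hc ha
  choose F hF hmin using hex
  have hle : ∀ u v, H.Adj u v → F u ≤ F v + a * colorStep c u v + 1 := by
    intro u v huv
    obtain ⟨k, w, x, h, e⟩ := hF v
    refine hmin u _ ⟨k + 1, w + colorStep c u v, x, ⟨v, huv, by rwa [add_sub_cancel_right]⟩, ?_⟩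
    rw [e]
    push_cast
    ring
  have haZ : Odd (a : ℤ) := by exact_mod_cast ha
  have heven : ∀ u, Even (F u) := by
    intro u
    obtain ⟨k, w, x, h, e⟩ := hF u
    have h1 := h.even_sub
    rw [e, show (a : ℤ) * w + k = (a + 1) * w - (w - k) by ring]
    exact (haZ.add_one.mul_right w).sub h1
  refine ⟨fun v => a * ((c v : ℕ) : ℤ) + F v, fun u v huv => ?_⟩
  refine ⟨F v - F u + a * colorStep c u v, ?_, ?_, ?_⟩
  · refine ((heven v).sub (heven u)).add_odd (haZ.mul ?_)
    rcases colorStep_eq_or c u v with h | h <;> rw [h] <;> decide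
  · have h1 := hle u v huv
    have h2 := hle v u huv.symm
    rw [colorStep_swap (hadj u v huv)] at h2
    rw [abs_le]
    constructor <;> linarith
  · obtain ⟨z, hz⟩ := three_dvd_sub_colorStep (hadj u v huv)
    exact ⟨z, by linear_combination (a : ℤ) * hz⟩

/-- After halving modulo `3a`, the three arcs of length `a` of the cycle `C_{3a}` are colour
classes of its `a`-th power. -/
theorem power_colorable_of_cyclePowerColorable {W : Type*} (H : SimpleGraph W) {a : ℕ}
    (ha : Odd a) (h : CyclePowerColorable H (3 * a) 1) : (power H a).Colorable 3 := by
  obtain ⟨p, hp⟩ := h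
  have hpos : (0 : ℤ) < a := by exact_mod_cast ha.pos
  have hodd : Odd (3 * (a : ℤ)) := by
    have : Odd (a : ℤ) := by exact_mod_cast ha
    exact Odd.mul (by decide) this
  have key : ∀ {u v : W} (q : H.Walk u v), ∃ D : ℤ, Even (D - q.length) ∧ |D| ≤ q.length ∧
      3 * (a : ℤ) ∣ p v - p u - D := by
    intro u v q
    induction q with
    | nil => exact ⟨0, by simp⟩
    | cons h q ih =>
      obtain ⟨D, hD, hDk, hdvd⟩ := ih
      obtain ⟨D', hD', hDk', hdvd'⟩ := hp _ _ h
      refine ⟨D + D', ?_, ?_, ?_⟩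
      · rw [SimpleGraph.Walk.length_cons, Nat.cast_add, Nat.cast_one, add_sub_add_comm]
        exact hD.add (hD'.sub_odd odd_one)
      · rw [SimpleGraph.Walk.length_cons, Nat.cast_add, Nat.cast_one]
        exact (abs_add_le _ _).trans (add_le_add hDk hDk')
      · obtain ⟨z, hz⟩ := hdvd
        obtain ⟨z', hz'⟩ := hdvd'
        exact ⟨z + z', by linear_combination hz + hz'⟩
  let y : W → ℤ := fun v => (p v * ((3 * (a : ℤ) + 1) / 2)) % (3 * a)
  have hy0 : ∀ v, 0 ≤ y v := fun v => Int.emod_nonneg _ (by omega)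
  have hym : ∀ v, y v < 3 * a := fun v => Int.emod_lt_of_pos _ (by omega)
  have hq0 : ∀ v, 0 ≤ y v / a := fun v => Int.ediv_nonneg (hy0 v) hpos.le
  have hq3 : ∀ v, y v / a < 3 := fun v => Int.ediv_lt_of_lt_mul hpos (hym v)
  refine ⟨fun v => ⟨(y v / a).toNat, by have := hq0 v; have := hq3 v; omega⟩, ?_⟩
  rintro u v ⟨q, hq⟩ heq
  rw [Fin.mk.injEq] at heq
  obtain ⟨D, hD, hDa, hdvd⟩ := key q
  rw [hq] at hD hDa
  have hDodd : Odd D := by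
    have haZ : Odd (a : ℤ) := by exact_mod_cast ha
    have := hD.add_odd haZ
    rwa [sub_add_cancel] at this
  obtain ⟨k, hk, e⟩ := exists_half_of_dvd hodd (by omega) _ _ D hDodd hdvd
  change 2 * (y v - y u) = D + 3 * a * k at e
  have hdiv : y v / a = y u / a := by
    have := hq0 u
    have := hq0 v
    omega
  have hu1 := Int.emod_add_mul_ediv (y u) a
  have hv1 := Int.emod_add_mul_ediv (y v) a
  rw [hdiv] at hv1
  have hu2 := Int.emod_nonneg (y u) hpos.ne'
  have hv2 := Int.emod_nonneg (y v) hpos.ne'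
  have hu3 := Int.emod_lt_of_pos (y u) hpos
  have hv3 := Int.emod_lt_of_pos (y v) hpos
  rw [abs_le] at hDa
  obtain ⟨i, rfl⟩ := hk
  -- `|2 (y v - y u)| < 2 a` and `|D| ≤ a` leave no room for an odd multiple of `3 a`
  rcases le_or_gt 0 i with h | h <;> nlinarith

/-! ### Chromatic number three -/

theorem LoopGraph.Colorable.mono {W : Type*} {H : LoopGraph W} {m n : ℕ} (hmn : m ≤ n)
    (h : H.Colorable m) : H.Colorable n := by
  obtain ⟨c, hc⟩ := h
  exact ⟨fun v => Fin.castLE hmn (c v), fun u v huv he =>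
    hc u v huv (Fin.castLE_injective hmn he)⟩

theorem LoopGraph.chromaticNumber_eq_three_iff {W : Type*} {H : LoopGraph W}
    (h2 : ¬ H.Colorable 2) : H.chromaticNumber = 3 ↔ H.Colorable 3 := by
  constructor
  · intro h
    have hlt : H.chromaticNumber < 4 := by rw [h]; norm_num
    unfold LoopGraph.chromaticNumber at hlt
    simp only [iInf_lt_iff] at hlt
    obtain ⟨n, hn, hn4⟩ := hlt
    have : n < 4 := by exact_mod_cast hn4
    exact hn.mono (by omega)
  · intro h
    refine le_antisymm (iInf₂_le 3 h) (le_iInf₂ fun n hn => ?_)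
    have : 3 ≤ n := by
      by_contra! hlt
      exact h2 (hn.mono (by omega))
    exact_mod_cast this

theorem not_fracPower_colorable_two {G : SimpleGraph V} (hG : ¬ G.IsBipartite) {a b : ℕ}
    (ha : Odd a) (hb : Odd b) : ¬ (fracPower G a b).Colorable 2 := by
  rintro ⟨c, hc⟩
  refine hG ⟨SimpleGraph.Coloring.mk (fun v => c (Sum.inl v)) fun {u v} => ?_⟩
  refine of_forall_edge_out (P := fun u v => c (Sum.inl u) ≠ c (Sum.inl v))
    (fun _ _ h => h.symm) (fun e => ?_) u v
  -- the two colours alternate along the path that replaces an edge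
  have key : ∀ k : ℕ, k ≤ b →
      ((c (subdivPoint G b e k) : ℕ) + c (subdivPoint G b e 0) + k) % 2 = 0 := by
    intro k
    induction k with
    | zero => intro _; omega
    | succ k ih =>
      intro hk
      have h1 := ih (by omega)
      have h2 : (c (subdivPoint G b e k) : ℕ) ≠ c (subdivPoint G b e (k + 1)) := fun h =>
        ne_of_adj_of_power_coloring hc ha (subdivision_adj G b e (k := k) (by omega)) (Fin.ext h)
      have h3 := (c (subdivPoint G b e k)).2
      have h4 := (c (subdivPoint G b e (k + 1))).2
      omega
  have h1 := key b le_rfl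
  rw [subdivPoint_zero, subdivPoint_last G hb.pos] at h1
  intro h
  rw [h] at h1
  obtain ⟨j, rfl⟩ := hb
  omega

/-- The fractional power `G^{a/b}` has chromatic number `3` exactly when
`a / b ≤ χ_c / (3 (χ_c - 2))`. -/
theorem fracPower_chromaticNumber_eq_three_iff [Finite V] {G : SimpleGraph V}
    (hG : ¬ G.IsBipartite) {k : ℕ} (hk : G.Colorable k) {a b : ℕ} (ha : Odd a) (hb : Odd b) :
    (fracPower G a b).chromaticNumber = 3 ↔
      3 * (a : ℝ) * (circularChromaticNumber G - 2) ≤ b * circularChromaticNumber G := by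
  rw [LoopGraph.chromaticNumber_eq_three_iff (not_fracPower_colorable_two hG ha hb)]
  have h3a : Odd (3 * a) := Odd.mul (by decide) ha
  have h1 : (fracPower G a b).Colorable 3 ↔ CyclePowerColorable (subdivision G b) (3 * a) 1 :=
    ⟨cyclePowerColorable_of_power_colorable _ ha, power_colorable_of_cyclePowerColorable _ ha⟩
  have h2 := cyclePowerColorable_iff G h3a hb
  push_cast at h2
  rw [h1, cyclePowerColorable_subdivision_iff G _ hb, h2]
  obtain ⟨hlt, hcol⟩ := circularColorable_iff_circularChromaticNumber_le hG hk
  rw [hcol]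
  set x := circularChromaticNumber G
  rcases le_or_gt (3 * a) b with h | h
  · have h' : 3 * (a : ℝ) ≤ b := by exact_mod_cast h
    have ha0 : (0 : ℝ) ≤ a := by positivity
    simp only [h, true_or, true_iff]
    nlinarith
  · have h' : 0 < 3 * (a : ℝ) - b := by
      have : (b : ℝ) < 3 * a := by exact_mod_cast h
      linarith
    simp only [not_le.2 h, false_or]
    rw [le_div_iff₀ h']
    constructor <;> intro <;> linarith

/-! ### Quotients of odd numbers -/

theorem exists_odd_div_odd_between {x y : ℝ} (hx : 0 < x) (hxy : x < y) :
    ∃ r s : ℕ, x < (2 * (r : ℝ) + 1) / (2 * (s : ℝ) + 1) ∧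
      (2 * (r : ℝ) + 1) / (2 * (s : ℝ) + 1) ≤ y := by
  obtain ⟨s₁, hs₁⟩ := exists_nat_gt (1 / (y - x))
  obtain ⟨s₂, hs₂⟩ := exists_nat_gt (1 / x)
  have hs₁' : 1 < s₁ * (y - x) := by rwa [div_lt_iff₀ (by linarith)] at hs₁
  have hs₂' : 1 < s₂ * x := by rwa [div_lt_iff₀ hx] at hs₂
  set s := s₁ + s₂
  have hs : (s : ℝ) = s₁ + s₂ := by simp [s]
  have hs1 : (0 : ℝ) ≤ s₁ := by positivity
  have hs2 : (0 : ℝ) ≤ s₂ := by positivity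
  have hlen : 2 < (2 * (s : ℝ) + 1) * (y - x) := by rw [hs]; nlinarith
  have hone : 1 < (2 * (s : ℝ) + 1) * x := by rw [hs]; nlinarith
  set z := ((2 * (s : ℝ) + 1) * x - 1) / 2 with hz
  have h1 := Nat.lt_floor_add_one z
  have h2 := Nat.floor_le (a := z) (by rw [hz]; linarith)
  have hpos : (0 : ℝ) < 2 * (s : ℝ) + 1 := by positivity
  refine ⟨⌊z⌋₊ + 1, s, ?_, ?_⟩
  · rw [lt_div_iff₀ hpos]
    push_cast
    linarith
  · rw [div_le_iff₀ hpos]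
    push_cast
    linarith

theorem exists_odd_div_sub_between {x y : ℝ} (hx : 2 < x) (hxy : x < y) :
    ∃ n t : ℕ, 0 < t ∧ t < n ∧ ((n : ℝ) - t) * x ≤ 2 * n + 1 ∧
      (2 * (n : ℝ) + 1) / ((n : ℝ) - t) < y := by
  obtain ⟨k₁, hk₁⟩ := exists_nat_gt (2 / (y - x))
  obtain ⟨k₂, hk₂⟩ := exists_nat_gt (1 / (x - 2))
  have hk₁' : 2 < k₁ * (y - x) := by rwa [div_lt_iff₀ (by linarith)] at hk₁
  have hk₂' : 1 < k₂ * (x - 2) := by rwa [div_lt_iff₀ (by linarith)] at hk₂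
  set k := k₁ + k₂
  have hk : (k : ℝ) = k₁ + k₂ := by simp [k]
  have hk1 : (0 : ℝ) ≤ k₁ := by positivity
  have hk2 : (0 : ℝ) ≤ k₂ := by positivity
  have hlen : 2 < (k : ℝ) * (y - x) := by rw [hk]; nlinarith
  have hone : 1 < (k : ℝ) * (x - 2) := by rw [hk]; nlinarith
  have hkpos : (0 : ℝ) < k := by
    by_contra! h
    nlinarith
  -- `(2 n + 1) / (n - t) = 2 + (2 t + 1) / k` with `k = n - t`
  set z := ((k : ℝ) * (x - 2) - 1) / 2 with hz
  have hz0 : 0 < z := by rw [hz]; linarith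
  have h1 := Nat.le_ceil z
  have h2 := Nat.ceil_lt_add_one hz0.le
  have hk0 : 0 < k := by exact_mod_cast hkpos
  have hsub : ((⌈z⌉₊ + k : ℕ) : ℝ) - ⌈z⌉₊ = k := by push_cast; ring
  refine ⟨⌈z⌉₊ + k, ⌈z⌉₊, Nat.ceil_pos.2 hz0, by omega, ?_, ?_⟩
  · rw [hsub]
    push_cast
    linarith
  · rw [hsub, div_lt_iff₀ hkpos]
    push_cast
    linarith

end FracPower

theorem theorem4 {V : Type*} [Finite V] (G : SimpleGraph V) (hG : ¬ G.IsBipartite)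
    (χ : ℕ) (hχ : G.chromaticNumber = (χ : ℕ∞)) :
    ((χ : ℝ) ≠ FracPower.circularChromaticNumber G ↔
      ∃ r s : ℕ, (χ : ℝ) / (3 * ((χ : ℝ) - 2)) < (2 * (r : ℝ) + 1) / (2 * (s : ℝ) + 1) ∧
        (FracPower.fracPower G (2 * r + 1) (2 * s + 1)).chromaticNumber = 3) ∧
    IsGLB {x : ℝ | ∃ n t : ℕ, 0 < t ∧ t < n ∧
        (FracPower.fracPower G (2 * n + 1) (3 * (2 * t + 1))).chromaticNumber = 3 ∧
        x = (2 * (n : ℝ) + 1) / ((n : ℝ) - (t : ℝ))}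
      (FracPower.circularChromaticNumber G) ∧
    (∀ r s : ℕ, (2 * (r : ℝ) + 1) / (2 * (s : ℝ) + 1) ≤ (χ : ℝ) / (3 * ((χ : ℝ) - 2)) →
      (FracPower.fracPower G (2 * r + 1) (2 * s + 1)).chromaticNumber = 3) := by
  have hk : G.Colorable χ := SimpleGraph.chromaticNumber_le_iff_colorable.1 hχ.le
  obtain ⟨hlt, hcol⟩ := FracPower.circularColorable_iff_circularChromaticNumber_le hG hk
  have hle := (hcol χ).1 (FracPower.circularColorable_of_colorable hk)
  have hodd : ∀ r s : ℕ,
      (FracPower.fracPower G (2 * r + 1) (2 * s + 1)).chromaticNumber = 3 ↔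
        3 * (2 * (r : ℝ) + 1) * (FracPower.circularChromaticNumber G - 2) ≤
          (2 * (s : ℝ) + 1) * FracPower.circularChromaticNumber G := fun r s => by
    rw [FracPower.fracPower_chromaticNumber_eq_three_iff hG hk ⟨r, rfl⟩ ⟨s, rfl⟩]
    push_cast
    rfl
  have hfrac : ∀ n t : ℕ, t < n →
      ((FracPower.fracPower G (2 * n + 1) (3 * (2 * t + 1))).chromaticNumber = 3 ↔
        ((n : ℝ) - t) * FracPower.circularChromaticNumber G ≤ 2 * n + 1) := fun n t htn => by
    rw [FracPower.fracPower_chromaticNumber_eq_three_iff hG hk ⟨n, rfl⟩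
      (Odd.mul (by decide) ⟨t, rfl⟩)]
    push_cast
    constructor <;> intro <;> linarith
  set x := FracPower.circularChromaticNumber G
  have hχ2 : (0 : ℝ) < 3 * ((χ : ℝ) - 2) := by linarith
  have hx2 : (0 : ℝ) < 3 * (x - 2) := by linarith
  refine ⟨⟨fun hne => ?_, ?_⟩, ⟨?_, fun y hy => ?_⟩, fun r s h => ?_⟩
  · have hxχ : x < χ := lt_of_le_of_ne hle hne.symm
    have h : (χ : ℝ) / (3 * ((χ : ℝ) - 2)) < x / (3 * (x - 2)) := by
      rw [div_lt_div_iff₀ hχ2 hx2]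
      linarith
    obtain ⟨r, s, h1, h2⟩ := FracPower.exists_odd_div_odd_between
      (div_pos (by linarith) hχ2) h
    refine ⟨r, s, h1, (hodd r s).2 ?_⟩
    rw [div_le_div_iff₀ (by positivity) hx2] at h2
    linarith
  · rintro ⟨r, s, h1, h2⟩ heq
    rw [hodd, ← heq] at h2
    rw [div_lt_div_iff₀ hχ2 (by positivity)] at h1
    linarith
  · rintro _ ⟨n, t, -, htn, h, rfl⟩
    have htn' : (0 : ℝ) < (n : ℝ) - t := sub_pos.2 (by exact_mod_cast htn)
    rw [le_div_iff₀ htn', mul_comm]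
    exact (hfrac n t htn).1 h
  · refine le_of_forall_gt_imp_ge_of_dense fun z hz => ?_
    obtain ⟨n, t, ht, htn, h1, h2⟩ := FracPower.exists_odd_div_sub_between hlt hz
    exact (hy ⟨n, t, ht, htn, (hfrac n t htn).2 h1, rfl⟩).trans h2.le
  · rw [hodd]
    rw [div_le_div_iff₀ (by positivity) hχ2] at h
    -- the bound for `χ` implies the one for `x ≤ χ`, after multiplication by `χ - 2 > 0`
    have hs : (0 : ℝ) < 2 * (s : ℝ) + 1 := by positivity
    have h' : ((χ : ℝ) - 2) * (3 * (2 * (r : ℝ) + 1) * (x - 2)) ≤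
        ((χ : ℝ) - 2) * ((2 * (s : ℝ) + 1) * x) := by
      nlinarith [mul_le_mul_of_nonneg_right h (by linarith : (0 : ℝ) ≤ x - 2),
        mul_nonneg hs.le (sub_nonneg.2 hle)]
    exact le_of_mul_le_mul_left h' (by linarith)
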